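/- Let $0<T\le\infty$, let $V$ be a real vector space and let $(\|\cdot\|_t)_{t\in(0,T)}$ be seminorms on $V$ such that $t\mapsto\|v\|_t$ is non-increasing for every $v\in V$. Let $X_t$ be the completion of $V/\ker\|\cdot\|_t$ (so $\{X_t\}$ is a monotone family of Banach spaces), and for $s\le t$ let $P(s,t):X_s\to X_t$ be the continuous extension of the identity of $V$. A section is a function $f$ on $(0,T)$ with $f(t)\in X_t$ for all $t$; it is measurable if it is the limit, for almost every $t$, in $X_t$, of simple sections $\sum_{k=1}^n\chi_{A_k}(t)v_k$ with $v_k\in V$ and $A_k\subset(0,T)$ measurable. For $1\le p\le\infty$, $L^p((0,T);\{X_t\})$ is the space of measurable sections $f$ with $t\mapsto\|f(t)\|_t$ in $L^p((0,T))$, normed by $\|f\|_{L^p((0,T);\{X_t\})}=\big\|\,\|f(\cdot)\|_{\cdot}\,\big\|_{L^p((0,T))}$; $L^1_{loc}((0,T);\{X_t\})$ is defined likewise. A function $g\in L^p((0,T))$ is a ($p$-integrable) upper gradient of a section $u$ if $$\|u(t)-P(s,t)u(s)\|_t\le\int_s^t g(\tau)\,d\tau\qquad\text{for almost all } s,t\in(0,T),\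 s\le t,$$ and $u\in W^{1,p}((0,T);\{X_t\})$ means that $u\in L^p((0,T);\{X_t\})$ and that $u$ has a $p$-integrable upper gradient. A section $v\in L^1_{loc}((0,T);\{X_t\})$ is a weak derivative of $u\in L^1_{loc}((0,T);\{X_t\})$ if for every nonzero $\varphi\in C_c^\infty((0,T))$, with $t^*=\sup\operatorname{supp}\varphi$, $$\int_0^{t^*}\varphi'(t)\,P(t,t^*)u(t)\,dt+\int_0^{t^*}\varphi(t)\,P(t,t^*)v(t)\,dt=0\quad\text{in }X_{t^*}.$$ **Theorem.** Suppose that every $X_t$, $t\in(0,T)$, is reflexive, let $1\le p\le\infty$, and let $u\in W^{1,p}((0,T);\{X_t\})$. Then there is a section $v\in L^p((0,T);\{X_t\})$ such that $v$ is a weak derivative of $u$, the function $t\mapsto\|v(t)\|_t$ is a $p$-integrable upper gradient of $u$, and $$\|v\|_{L^p((0,T);\{X_t\})}=\inf_g\|g\|_{L^p((0,T))},$$ where the infimum is taken over all $p$-integrable upper gradients $g$ of $u$. -/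

import Mathlib

open MeasureTheory Filter Topology
open scoped ENNReal ContDiff

/-- The open time interval `(0, T)`; the endpoint `T` is an extended real, so that the interval
is allowed to be unbounded. -/
def timeInterval (T : EReal) : Set ℝ := {t : ℝ | 0 < t ∧ (t : EReal) < T}

/-- Lebesgue measure on `(0, T)`. -/
noncomputable def timeMeasure (T : EReal) : Measure (timeInterval T) :=
  (volume : Measure ℝ).comap Subtype.val

/-- A copy of the vector space `V`, carrying the seminorm `q`. -/
def SeminormCopy {V : Type*} [AddCommGroup V] [Module ℝ V] (_q : Seminorm ℝ V) : Type _ := V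

namespace SeminormCopy

variable {V : Type*} [AddCommGroup V] [Module ℝ V] (q : Seminorm ℝ V)

noncomputable instance : SeminormedAddCommGroup (SeminormCopy q) :=
  q.toAddGroupSeminorm.toSeminormedAddCommGroup

instance : Module ℝ (SeminormCopy q) := inferInstanceAs (Module ℝ V)

/-- The identity map from `V` to the copy of `V` that carries the seminorm `q`. -/
def of : V →ₗ[ℝ] SeminormCopy q := LinearMap.id

theorem norm_of (v : V) : ‖of q v‖ = q v := rfl

noncomputable instance : NormedSpace ℝ (SeminormCopy q) where
  norm_smul_le a v := (map_smul_eq_mul q a v).le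

end SeminormCopy

/-- A monotone family: seminorms `N t`, `t ∈ (0, T)`, on a real vector space `V`, such that
`t ↦ N t v` is non-increasing for every `v`. The Banach spaces that it generates are
`MonotoneFamily.X` below. -/
structure MonotoneFamily (T : EReal) (V : Type*) [AddCommGroup V] [Module ℝ V] where
  /-- The seminorm at time `t`. -/
  N : timeInterval T → Seminorm ℝ V
  /-- The seminorms are non-increasing in time. -/
  antitone_N : ∀ v : V, Antitone fun t => N t v

/-- A real normed space is reflexive if its canonical map into the bidual is surjective. -/
def IsReflexiveSpace (E : Type*) [NormedAddCommGroup E] [NormedSpace ℝ E] : Prop :=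
  Function.Surjective (NormedSpace.inclusionInDoubleDual ℝ E)

namespace MonotoneFamily

variable {T : EReal} {V : Type*} [AddCommGroup V] [Module ℝ V] (M : MonotoneFamily T V)

/-- The Banach space `X t`. Mathlib's completion of a seminormed space is the Hausdorff
completion, that is, the completion of the quotient by the kernel of the seminorm. -/
abbrev X (t : timeInterval T) : Type _ := UniformSpace.Completion (SeminormCopy (M.N t))

/-- The canonical map `V → X t`. -/
noncomputable def toX (t : timeInterval T) : V →ₗ[ℝ] M.X t :=
  (UniformSpace.Completion.toComplL (𝕜 := ℝ) (E := SeminormCopy (M.N t))).toLinearMap ∘ₗ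
    SeminormCopy.of (M.N t)

theorem norm_toX (t : timeInterval T) (v : V) : ‖M.toX t v‖ = M.N t v :=
  UniformSpace.Completion.norm_coe (SeminormCopy.of (M.N t) v)

theorem denseRange_toX (t : timeInterval T) : DenseRange (M.toX t) :=
  UniformSpace.Completion.denseRange_coe (α := SeminormCopy (M.N t))

/-- The identity of `V`, as a continuous map from `(V, N s)` to `(V, N t)` for `s ≤ t`. -/
noncomputable def idCLM {s t : timeInterval T} (h : s ≤ t) :
    SeminormCopy (M.N s) →L[ℝ] SeminormCopy (M.N t) :=
  LinearMap.mkContinuous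
    { toFun := fun v => v, map_add' := fun _ _ => rfl, map_smul' := fun _ _ => rfl } 1
    (fun v => by rw [one_mul]; exact M.antitone_N v h)

/-- The transition operator `P s t : X s → X t`, `s ≤ t`: the continuous extension of the
identity of `V` to the completions. -/
noncomputable def P {s t : timeInterval T} (h : s ≤ t) : M.X s →L[ℝ] M.X t :=
  (M.idCLM h).completion

theorem P_toX {s t : timeInterval T} (h : s ≤ t) (v : V) : M.P h (M.toX s v) = M.toX t v :=
  UniformSpace.Completion.map_coe (M.idCLM h).uniformContinuous (SeminormCopy.of (M.N s) v)

/-- Sections of the family: functions `f` with `f t ∈ X t` for all `t ∈ (0, T)`. -/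
abbrev Sec : Type _ := ∀ t : timeInterval T, M.X t

/-- A section is simple if it has the form `f t = ∑ k, χ_{A k}(t) v k` with finitely many vectors
`v k ∈ V` and measurable sets `A k`; here this finite sum is a simple function with values
in `V`. -/
def IsSimpleSection (f : M.Sec) : Prop :=
  ∃ s : SimpleFunc (timeInterval T) V, ∀ t, f t = M.toX t (s t)

/-- A section is measurable if it is the limit, at almost every time, of simple sections. -/
def IsMeasurableSection (f : M.Sec) : Prop :=
  ∃ F : ℕ → M.Sec, (∀ k, M.IsSimpleSection (F k)) ∧
    ∀ᵐ t ∂(timeMeasure T), Tendsto (fun k => F k t) atTop (𝓝 (f t))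

/-- The `L^p` norm of a section: the `L^p` norm of the function `t ↦ ‖f t‖`. -/
noncomputable def secLpNorm (p : ℝ≥0∞) (f : M.Sec) : ℝ≥0∞ :=
  eLpNorm (fun t => ‖f t‖) p (timeMeasure T)

/-- `f ∈ L^p((0, T); {X t})`. -/
def MemLpSec (p : ℝ≥0∞) (f : M.Sec) : Prop :=
  M.IsMeasurableSection f ∧ MemLp (fun t => ‖f t‖) p (timeMeasure T)

/-- `f ∈ L^1_loc((0, T); {X t})`. -/
def MemL1LocSec (f : M.Sec) : Prop :=
  M.IsMeasurableSection f ∧ LocallyIntegrable (fun t => ‖f t‖) (timeMeasure T)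

/-- `g` is a `p`-integrable upper gradient of `u`: `g ∈ L^p((0, T))` and
`‖u t - P s t (u s)‖ ≤ ∫_s^t g` for almost all `s ≤ t`, that is, for all `s ≤ t` outside of a set
of measure zero. -/
def IsUpperGradient (p : ℝ≥0∞) (u : M.Sec) (g : timeInterval T → ℝ) : Prop :=
  MemLp g p (timeMeasure T) ∧
    ∃ E : Set (timeInterval T), timeMeasure T E = 0 ∧
      ∀ (s t : timeInterval T) (h : s ≤ t), s ∉ E → t ∉ E →
        ‖u t - M.P h (u s)‖ ≤ ∫ τ in Set.Icc s t, g τ ∂(timeMeasure T)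

/-- `u ∈ W^{1,p}((0, T); {X t})`, in the Newtonian sense. -/
def MemW1p (p : ℝ≥0∞) (u : M.Sec) : Prop :=
  M.MemLpSec p u ∧ ∃ g : timeInterval T → ℝ, M.IsUpperGradient p u g

/-- The section `f` on `(0, b]`, transported to the fixed space `X b`, and extended by zero. -/
noncomputable def transport (b : timeInterval T) (f : M.Sec) (t : timeInterval T) : M.X b :=
  open scoped Classical in if h : t ≤ b then M.P h (f t) else 0

/-- `g` is a weak derivative of `f`: both are in `L^1_loc((0, T); {X t})`, and
`∫ φ' f + ∫ φ g = 0` in `X b`, `b = sup (supp φ)`, for every test function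
`φ ∈ C_c^∞((0, T))`. The integrals are Bochner integrals in `X b` (the function `φ = 0`, whose
support has no supremum, is void). -/
def IsWeakDeriv (f g : M.Sec) : Prop :=
  M.MemL1LocSec f ∧ M.MemL1LocSec g ∧
    ∀ φ : ℝ → ℝ, ContDiff ℝ ∞ φ → HasCompactSupport φ → tsupport φ ⊆ timeInterval T →
      ∀ b : timeInterval T, IsLUB (tsupport φ) (b : ℝ) →
        (∫ t, deriv φ (t : ℝ) • M.transport b f t ∂(timeMeasure T)) +
          (∫ t, φ (t : ℝ) • M.transport b g t ∂(timeMeasure T)) = 0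

end MonotoneFamily

/-! The derivative `v t` is the weak limit in `X t`, along one fixed ultrafilter, of the difference
quotients `(n+1) (u t - P u(t - 1/(n+1)))`. They look backward because only the past can be
transported into `X t`. Any upper gradient `g` bounds them by averages of `g`, which tend to `g t`
at almost every time; reflexivity then gives the limit, with `‖v t‖ ≤ g t`. The choice of `v` does
not involve `g`, so this bound holds for all upper gradients at once and yields minimality.

A functional `ℓ` on a fixed `X b` reduces calculus to scalars: `t ↦ ℓ (P u t)` agrees off a null set
with an absolutely continuous function, whose derivative is `ℓ (P v t)` almost everywhere
(`exists_deriv_transport`). Norming functionals then turn integration by parts into the weak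
derivative identity, and the fundamental theorem into the upper gradient inequality.

Measurability of `v` is a Pettis argument in varying spaces (`isMeasurableSection_of_weak`). Closed
subspaces are weakly closed, so `v` inherits separable values from `u`; at almost every time its
norm is recovered from transports to countably many later times. -/

/-! ### Scalar functions with an integrable upper gradient. -/

theorem LipschitzWith.comp_absolutelyContinuousOnInterval {φ G : ℝ → ℝ} {a b : ℝ}
    (hφ : LipschitzWith 1 φ) (hG : AbsolutelyContinuousOnInterval G a b) :
    AbsolutelyContinuousOnInterval (φ ∘ G) a b := by
  rw [absolutelyContinuousOnInterval_iff] at hG ⊢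
  intro ε hε
  obtain ⟨δ, hδ, h⟩ := hG ε hε
  refine ⟨δ, hδ, fun J hJ hJδ => lt_of_le_of_lt ?_ (h J hJ hJδ)⟩
  refine Finset.sum_le_sum fun i _ => ?_
  simpa using hφ.dist_le_mul (G (J.2 i).1) (G (J.2 i).2)

theorem HasDerivAt.tendsto_backward_quotient {F : ℝ → ℝ} {F' t : ℝ} (h : HasDerivAt F F' t) :
    Tendsto (fun n : ℕ => ((n : ℝ) + 1) * (F t - F (t - 1 / ((n : ℝ) + 1)))) atTop (𝓝 F') := by
  have h0 : Tendsto (fun n : ℕ => -(1 / ((n : ℝ) + 1))) atTop (𝓝[≠] 0) := by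
    refine tendsto_nhdsWithin_iff.2 ⟨?_, Eventually.of_forall fun n => ?_⟩
    · simpa using (tendsto_one_div_add_atTop_nhds_zero_nat (𝕜 := ℝ)).neg
    · have : (0 : ℝ) < 1 / ((n : ℝ) + 1) := by positivity
      simpa using this.ne'
  refine (h.tendsto_slope_zero.comp h0).congr fun n => ?_
  simp only [Function.comp_apply, smul_eq_mul, ← sub_eq_add_neg]
  rw [inv_neg, one_div, inv_inv]
  ring

/-- Countably many translates of a null set are jointly null; this is why the steps are restricted
to `1 / (n + 1)`. -/
theorem ae_forall_sub_notMem {E : Set ℝ} (hE : volume E = 0) :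
    ∀ᵐ t : ℝ, t ∉ E ∧ ∀ n : ℕ, t - 1 / ((n : ℝ) + 1) ∉ E := by
  refine (measure_eq_zero_iff_ae_notMem.1 hE).and (ae_all_iff.2 fun n => ?_)
  exact measure_eq_zero_iff_ae_notMem.1
    ((measurePreserving_sub_right volume (1 / ((n : ℝ) + 1))).quasiMeasurePreserving.preimage_null
      hE)

theorem ae_tendsto_backward_average {b : ℝ} {g : ℝ → ℝ} (hb : 0 ≤ b)
    (hg : IntervalIntegrable g volume 0 b) :
    ∀ᵐ t : ℝ, t ∈ Set.Ioo 0 b →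
      Tendsto (fun n : ℕ => ((n : ℝ) + 1) * ∫ τ in (t - 1 / ((n : ℝ) + 1))..t, g τ) atTop
        (𝓝 (g t)) := by
  filter_upwards [hg.ae_hasDerivAt_integral] with t ht htb
  have ht' : t ∈ Set.uIcc 0 b := by
    rw [Set.uIcc_of_le hb]; exact ⟨htb.1.le, htb.2.le⟩
  have h := (ht ht' t ht').tendsto_backward_quotient
  refine h.congr fun n => ?_
  rw [intervalIntegral.integral_same, zero_sub, intervalIntegral.integral_symm t]

/-- A function with an integrable upper gradient off a null set is there equal to an absolutely
continuous function. -/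
theorem exists_absolutelyContinuousOnInterval_eq {b : ℝ} (hb : 0 ≤ b) {g f : ℝ → ℝ} {E : Set ℝ}
    (hg : IntervalIntegrable g volume 0 b)
    (hf : ∀ s t, 0 < s → s ≤ t → t ≤ b → s ∉ E → t ∉ E → |f t - f s| ≤ ∫ τ in s..t, g τ) :
    ∃ F : ℝ → ℝ, AbsolutelyContinuousOnInterval F 0 b ∧
      ∀ t, 0 < t → t ≤ b → t ∉ E → F t = f t := by
  set G : ℝ → ℝ := fun t => ∫ τ in (0 : ℝ)..t, g τ with hG
  have hint : ∀ t, 0 < t → t ≤ b → IntervalIntegrable g volume 0 t := fun t h0 h1 =>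
    hg.mono_set (by rw [Set.uIcc_of_le hb, Set.uIcc_of_le h0.le]; exact Set.Icc_subset_Icc_right h1)
  set A : Set ℝ := {t | 0 < t ∧ t ≤ b ∧ t ∉ E}
  have key : ∀ s ∈ A, ∀ t ∈ A, |f t - f s| ≤ |G t - G s| := by
    have aux : ∀ s ∈ A, ∀ t ∈ A, s ≤ t → |f t - f s| ≤ |G t - G s| := by
      intro s hs t ht hst
      refine (hf s t hs.1 hst ht.2.1 hs.2.2 ht.2.2).trans ?_
      rw [hG]
      simp only
      rw [intervalIntegral.integral_interval_sub_left (hint t ht.1 ht.2.1) (hint s hs.1 hs.2.1)]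
      exact le_abs_self _
    intro s hs t ht
    rcases le_total s t with h | h
    · exact aux s hs t ht h
    · rw [abs_sub_comm, abs_sub_comm (G t)]
      exact aux t ht s hs h
  classical
  -- By `key`, `f` on `A` factors as a 1-Lipschitz function of the absolutely continuous `G`.
  -- Extending that function to all of `ℝ` gives `F = φ ∘ G`.
  set φ₀ : ℝ → ℝ := fun y => if h : ∃ s ∈ A, G s = y then f h.choose else 0 with hφ₀
  have hφG : ∀ s ∈ A, φ₀ (G s) = f s := by
    intro s hs
    have h : ∃ r ∈ A, G r = G s := ⟨s, hs, rfl⟩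
    rw [hφ₀]
    simp only [dif_pos h]
    have := key s hs _ h.choose_spec.1
    rw [h.choose_spec.2, sub_self, abs_zero] at this
    exact sub_eq_zero.1 (abs_eq_zero.1 (le_antisymm this (abs_nonneg _)))
  have hL : LipschitzOnWith 1 φ₀ (G '' A) := by
    refine LipschitzOnWith.of_dist_le_mul ?_
    rintro _ ⟨s, hs, rfl⟩ _ ⟨t, ht, rfl⟩
    rw [hφG s hs, hφG t ht, Real.dist_eq, Real.dist_eq, NNReal.coe_one, one_mul]
    exact key t ht s hs
  obtain ⟨φ, hφ, hφe⟩ := hL.extend_real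
  refine ⟨φ ∘ G, hφ.comp_absolutelyContinuousOnInterval
    (hg.absolutelyContinuousOnInterval_intervalIntegral Set.left_mem_uIcc), fun t h0 h1 h2 => ?_⟩
  have : t ∈ A := ⟨h0, h1, h2⟩
  rw [Function.comp_apply, ← hφe ⟨t, this, rfl⟩, hφG t this]

/-- A function `f` with an integrable upper gradient off a null set `E` has a
derivative `D`. -/
theorem exists_deriv_of_abs_sub_le_integral {b : ℝ} (hb : 0 ≤ b) {g f : ℝ → ℝ} {E : Set ℝ}
    (hE : volume E = 0) (hg : IntervalIntegrable g volume 0 b)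
    (hf : ∀ s t, 0 < s → s ≤ t → t ≤ b → s ∉ E → t ∉ E → |f t - f s| ≤ ∫ τ in s..t, g τ) :
    ∃ D : ℝ → ℝ, Measurable D ∧
      (∀ s t, 0 < s → s ≤ t → t ≤ b → s ∉ E → t ∉ E → f t - f s = ∫ τ in s..t, D τ) ∧
      (∀ φ : ℝ → ℝ, ContDiff ℝ 1 φ → φ 0 = 0 → φ b = 0 →
        (∫ t in (0 : ℝ)..b, deriv φ t * f t) + ∫ t in (0 : ℝ)..b, φ t * D t = 0) ∧
      ∀ᵐ t : ℝ, t ∈ Set.Ioo 0 b →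
        Tendsto (fun n : ℕ => ((n : ℝ) + 1) * (f t - f (t - 1 / ((n : ℝ) + 1)))) atTop
          (𝓝 (D t)) := by
  obtain ⟨F, hF, hFf⟩ := exists_absolutelyContinuousOnInterval_eq hb hg hf
  refine ⟨deriv F, measurable_deriv F, ?_, ?_, ?_⟩
  · intro s t h0 hst htb hs ht
    rw [← hFf t (h0.trans_le hst) htb ht, ← hFf s h0 (hst.trans htb) hs]
    refine (AbsolutelyContinuousOnInterval.integral_deriv_eq_sub (hF.mono ?_)).symm
    rw [Set.uIcc_of_le hb, Set.uIcc_of_le hst]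
    exact Set.Icc_subset_Icc h0.le htb
  · intro φ hφ h0 h1
    have hφ' : AbsolutelyContinuousOnInterval φ 0 b := hφ.contDiffOn.absolutelyContinuousOnInterval
    have := hφ'.integral_mul_deriv_eq_deriv_mul hF
    rw [this, h0, h1]
    have e : ∫ t in (0 : ℝ)..b, deriv φ t * f t = ∫ t in (0 : ℝ)..b, deriv φ t * F t := by
      refine intervalIntegral.integral_congr_ae ?_
      filter_upwards [measure_eq_zero_iff_ae_notMem.1 hE] with t ht htb
      rw [Set.uIoc_of_le hb] at htb
      rw [hFf t htb.1 htb.2 ht]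
    rw [e]; ring
  · filter_upwards [hF.ae_differentiableAt, ae_forall_sub_notMem hE] with t ht htE htb
    have ht' : t ∈ Set.uIcc 0 b := by
      rw [Set.uIcc_of_le hb]; exact ⟨htb.1.le, htb.2.le⟩
    refine (ht ht').hasDerivAt.tendsto_backward_quotient.congr' ?_
    have : ∀ᶠ n : ℕ in atTop, 1 / ((n : ℝ) + 1) < t :=
      (tendsto_one_div_add_atTop_nhds_zero_nat (𝕜 := ℝ)).eventually_lt_const htb.1
    filter_upwards [this] with n hn
    have hn' : (0 : ℝ) < 1 / ((n : ℝ) + 1) := by positivity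
    rw [hFf t htb.1 htb.2.le htE.1, hFf _ (sub_pos.2 hn) (by linarith [htb.2]) (htE.2 n)]

/-! ### Weak limits, norming functionals and dense sequences. -/

section FunctionalAnalysis

variable {E : Type*} [NormedAddCommGroup E] [NormedSpace ℝ E]

/-- Bounded sequences in a reflexive space converge weakly along ultrafilters. -/
theorem IsReflexiveSpace.exists_weak_limit (hE : IsReflexiveSpace E) (𝒰 : Ultrafilter ℕ)
    {q : ℕ → E} {C : ℝ} (hC : ∀ᶠ n in (𝒰 : Filter ℕ), ‖q n‖ ≤ C) :
    ∃ v : E, ∀ ℓ : StrongDual ℝ E, Tendsto (fun n => ℓ (q n)) 𝒰 (𝓝 (ℓ v)) := by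
  have hbd : ∀ ℓ : StrongDual ℝ E, ∀ᶠ n in (𝒰 : Filter ℕ), |ℓ (q n)| ≤ C * ‖ℓ‖ := fun ℓ => by
    filter_upwards [hC] with n hn
    rw [← Real.norm_eq_abs, mul_comm]
    exact (ℓ.le_opNorm _).trans (by gcongr)
  have hlim : ∀ ℓ : StrongDual ℝ E, ∃ y : ℝ, Tendsto (fun n => ℓ (q n)) 𝒰 (𝓝 y) := fun ℓ => by
    have hK : IsCompact (Set.Icc (-(C * ‖ℓ‖)) (C * ‖ℓ‖)) := isCompact_Icc
    obtain ⟨y, -, hy⟩ := hK.ultrafilter_le_nhds (𝒰.map fun n => ℓ (q n)) (by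
      rw [le_principal_iff]
      exact (hbd ℓ).mono fun n hn => abs_le.1 hn)
    exact ⟨y, hy⟩
  -- The ultrafilter gives limits for all functionals simultaneously, so `Λ` is linear and bounded
  -- by `C`: an element of the bidual, which reflexivity represents by a vector.
  choose Λ hΛ using hlim
  let Λ' : StrongDual ℝ E →ₗ[ℝ] ℝ :=
    { toFun := Λ
      map_add' := fun ℓ m => tendsto_nhds_unique (hΛ (ℓ + m)) (by simpa using (hΛ ℓ).add (hΛ m))
      map_smul' := fun c ℓ =>
        tendsto_nhds_unique (hΛ (c • ℓ)) (by simpa using (hΛ ℓ).const_mul c) }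
  obtain ⟨v, hv⟩ := hE (Λ'.mkContinuous C fun ℓ =>
    le_of_tendsto (continuous_abs.continuousAt.tendsto.comp (hΛ ℓ)) (hbd ℓ))
  refine ⟨v, fun ℓ => ?_⟩
  have : ℓ v = Λ ℓ := by
    rw [← NormedSpace.dual_def ℝ E v ℓ, hv]; rfl
  rw [this]
  exact hΛ ℓ

theorem norm_le_of_weak_limit {𝒰 : Filter ℕ} [𝒰.NeBot] {q : ℕ → E} {v : E}
    (hv : ∀ ℓ : StrongDual ℝ E, Tendsto (fun n => ℓ (q n)) 𝒰 (𝓝 (ℓ v)))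
    {c : ℕ → ℝ} {c' : ℝ} (hc : Tendsto c 𝒰 (𝓝 c')) (hq : ∀ᶠ n in 𝒰, ‖q n‖ ≤ c n) : ‖v‖ ≤ c' := by
  obtain ⟨ℓ, hℓ, hℓv⟩ := exists_dual_vector'' ℝ v
  have : ℓ v ≤ c' := by
    refine le_of_tendsto_of_tendsto (hv ℓ) hc ?_
    filter_upwards [hq] with n hn
    calc ℓ (q n) ≤ ‖ℓ (q n)‖ := Real.le_norm_self _
      _ ≤ 1 * ‖q n‖ := ℓ.le_of_opNorm_le hℓ _
      _ ≤ c n := by rwa [one_mul]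
  rw [hℓv] at this
  exact this

/-- Hahn–Banach separation: closed subspaces are weakly closed. This carries separability of the
values from `u` to its derivative. -/
theorem mem_of_weak_limit {𝒰 : Filter ℕ} [𝒰.NeBot] {q : ℕ → E} {v : E}
    (hv : ∀ ℓ : StrongDual ℝ E, Tendsto (fun n => ℓ (q n)) 𝒰 (𝓝 (ℓ v)))
    {Y : Submodule ℝ E} (hY : IsClosed (Y : Set E)) (hq : ∀ᶠ n in 𝒰, q n ∈ Y) : v ∈ Y := by
  by_contra hvY
  obtain ⟨ℓ, c, h₁, h₂⟩ := geometric_hahn_banach_closed_point Y.convex hY hvY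
  refine absurd (le_of_tendsto (hv ℓ) ?_) (not_le.2 h₂)
  filter_upwards [hq] with n hn using (h₁ _ hn).le

/-- A separable set has a countable norming family of functionals. -/
theorem exists_norming_functionals {ι : Type*} (d : ι → E) :
    ∃ ℓ : ι → StrongDual ℝ E, (∀ i, ‖ℓ i‖ ≤ 1) ∧
      ∀ y ∈ closure (Set.range d), ‖y‖ₑ = ⨆ i, ‖ℓ i y‖ₑ := by
  choose ℓ hℓ hℓd using fun i => exists_dual_vector'' ℝ (d i)
  refine ⟨ℓ, hℓ, fun y hy => le_antisymm ?_ (iSup_le fun i => ?_)⟩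
  · by_cases hS : (⨆ i, ‖ℓ i y‖ₑ) = ⊤
    · rw [hS]; exact le_top
    have hi : ∀ i, ‖ℓ i y‖ ≤ (⨆ i, ‖ℓ i y‖ₑ).toReal := fun i => by
      rw [← toReal_enorm]
      exact ENNReal.toReal_mono hS (le_iSup (fun i => ‖ℓ i y‖ₑ) i)
    rw [← ENNReal.ofReal_toReal hS, ← ofReal_norm]
    refine ENNReal.ofReal_le_ofReal (le_of_forall_pos_le_add fun ε hε => ?_)
    -- The distance to `d i` is paid twice: in passing from `y` to `d i`, where `ℓ i` attains the
    -- norm, and back.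
    obtain ⟨_, ⟨i, rfl⟩, hi'⟩ := Metric.mem_closure_iff.1 hy (ε / 2) (half_pos hε)
    rw [dist_eq_norm] at hi'
    have h1 : ‖ℓ i (y - d i)‖ ≤ ‖y - d i‖ := by simpa using (ℓ i).le_of_opNorm_le (hℓ i) (y - d i)
    have h2 : ‖d i‖ ≤ ‖ℓ i y‖ + ‖ℓ i (y - d i)‖ := by
      calc ‖d i‖ = ‖ℓ i (d i)‖ := by rw [hℓd]; simp
        _ = ‖ℓ i y - ℓ i (y - d i)‖ := by simp
        _ ≤ _ := norm_sub_le _ _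
    have h3 : ‖y‖ ≤ ‖d i‖ + ‖y - d i‖ := by
      simpa using norm_add_le (d i) (y - d i)
    linarith [hi i]
  · rw [← ofReal_norm, ← ofReal_norm]
    exact ENNReal.ofReal_le_ofReal (by simpa using (ℓ i).le_of_opNorm_le (hℓ i) y)

end FunctionalAnalysis

/-- The span of a countable set contains a sequence that is dense for all seminorms. -/
theorem exists_seq_dense_span {V : Type*} [AddCommGroup V] [Module ℝ V] {C : Set V}
    (hC : C.Countable) :
    ∃ x : ℕ → V, (∀ n, x n ∈ Submodule.span ℝ C) ∧
      ∀ w ∈ Submodule.span ℝ C, ∀ q : Seminorm ℝ V, ∀ ε > 0, ∃ n, q (w - x n) < ε := by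
  have := hC.to_subtype
  -- Only coefficients are approximated, by rationals, so one countable family serves all seminorms
  -- and hence all `X t`.
  let L : (C →₀ ℚ) → V := fun f => f.sum fun c r => (r : ℝ) • (c : V)
  have hL0 : L 0 = 0 := Finsupp.sum_zero_index
  have hLadd : ∀ f g, L (f + g) = L f + L g := fun f g =>
    Finsupp.sum_add_index' (by simp) (by intro c r s; push_cast; exact add_smul _ _ _)
  have hLspan : ∀ f, L f ∈ Submodule.span ℝ C := fun f =>
    Submodule.sum_mem _ fun c _ => Submodule.smul_mem _ _ (Submodule.subset_span c.2)
  obtain ⟨e, he⟩ := exists_surjective_nat (C →₀ ℚ)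
  refine ⟨fun n => L (e n), fun n => hLspan _, fun w hw q => ?_⟩
  -- The free scalar `r` lets the `smul` case absorb its real factor.
  have key : ∀ r : ℝ, ∀ ε > 0, ∃ f, q (r • w - L f) < ε := by
    induction hw using Submodule.span_induction with
    | mem c hc =>
      intro r ε hε
      obtain ⟨s, hs⟩ := exists_rat_near r (show 0 < ε / (q c + 1) by positivity)
      refine ⟨Finsupp.single ⟨c, hc⟩ s, ?_⟩
      have : L (Finsupp.single ⟨c, hc⟩ s) = (s : ℝ) • c := Finsupp.sum_single_index (by simp)
      rw [this, ← sub_smul, map_smul_eq_mul, Real.norm_eq_abs]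
      rw [lt_div_iff₀ (by positivity)] at hs
      have : |r - s| * q c ≤ |r - s| * (q c + 1) := by gcongr; linarith
      linarith
    | zero => intro r ε hε; exact ⟨0, by simpa [hL0] using hε⟩
    | add a b _ _ ha hb =>
      intro r ε hε
      obtain ⟨f, hf⟩ := ha r (ε / 2) (half_pos hε)
      obtain ⟨g, hg⟩ := hb r (ε / 2) (half_pos hε)
      refine ⟨f + g, ?_⟩
      have : r • (a + b) - L (f + g) = (r • a - L f) + (r • b - L g) := by
        rw [hLadd, smul_add]; abel
      rw [this]
      linarith [map_add_le_add q (r • a - L f) (r • b - L g)]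
    | smul a w _ hw => intro r ε hε; simpa [smul_smul] using hw (r * a) ε hε
  intro ε hε
  obtain ⟨f, hf⟩ := key 1 ε hε
  obtain ⟨n, rfl⟩ := he f
  exact ⟨n, by simpa using hf⟩

/-! ### Measure and integration on the time interval. -/

section TimeInterval

variable {T : EReal}

instance : (timeInterval T).OrdConnected :=
  ⟨fun _ hx _ hy _ hz => ⟨hx.1.trans_le hz.1, (EReal.coe_le_coe_iff.2 hz.2).trans_lt hy.2⟩⟩

theorem isOpen_timeInterval : IsOpen (timeInterval T) :=
  isOpen_Ioi.inter (isOpen_Iio.preimage continuous_coe_real_ereal)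

theorem measurableSet_timeInterval : MeasurableSet (timeInterval T) :=
  isOpen_timeInterval.measurableSet

instance : NoMaxOrder (timeInterval T) := by
  refine ⟨fun t => ?_⟩
  obtain ⟨r, hr, hrT⟩ := EReal.lt_iff_exists_real_btwn.1 t.2.2
  have := EReal.coe_lt_coe_iff.1 hr
  exact ⟨⟨r, t.2.1.trans this, hrT⟩, this⟩

theorem measurableEmbedding_timeInterval_coe :
    MeasurableEmbedding (Subtype.val : timeInterval T → ℝ) :=
  MeasurableEmbedding.subtype_coe measurableSet_timeInterval

theorem measurePreserving_timeInterval_coe :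
    MeasurePreserving (Subtype.val : timeInterval T → ℝ) (timeMeasure T)
      (volume.restrict (timeInterval T)) :=
  ⟨measurable_subtype_coe, map_comap_subtype_coe measurableSet_timeInterval volume⟩

theorem timeMeasure_preimage (s : Set ℝ) :
    timeMeasure T (Subtype.val ⁻¹' s) = volume.restrict (timeInterval T) s :=
  measurePreserving_timeInterval_coe.measure_preimage_emb measurableEmbedding_timeInterval_coe s

theorem timeMeasure_eq_zero_iff {E : Set (timeInterval T)} :
    timeMeasure T E = 0 ↔ volume (Subtype.val '' E) = 0 := by
  rw [timeMeasure, comap_subtype_coe_apply measurableSet_timeInterval]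

instance : NullSingletonClass (timeMeasure T) :=
  ⟨fun t => timeMeasure_eq_zero_iff.2 (by simp)⟩

theorem ae_timeMeasure_of_ae {p : ℝ → Prop} (h : ∀ᵐ x : ℝ, p x) :
    ∀ᵐ t : timeInterval T ∂(timeMeasure T), p (t : ℝ) :=
  measurePreserving_timeInterval_coe.quasiMeasurePreserving.ae (ae_restrict_of_ae h)

theorem timeMeasure_Iic_lt_top (b : timeInterval T) : timeMeasure T (Set.Iic b) < ⊤ := by
  have : Set.Iic b = Subtype.val ⁻¹' (Set.Ioc 0 (b : ℝ)) := by
    ext t; exact ⟨fun h => ⟨t.2.1, h⟩, fun h => h.2⟩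
  rw [this, timeMeasure_preimage]
  exact (Measure.restrict_apply_le _ _).trans_lt measure_Ioc_lt_top

instance : IsLocallyFiniteMeasure (timeMeasure T) :=
  ⟨fun t => by
    obtain ⟨b, hb⟩ := exists_gt t
    exact ⟨Set.Iic b, Iic_mem_nhds hb, timeMeasure_Iic_lt_top b⟩⟩

theorem setIntegral_Iic_timeMeasure {E : Type*} [NormedAddCommGroup E] [NormedSpace ℝ E]
    (b : timeInterval T) (f : ℝ → E) :
    ∫ τ in Set.Iic b, f τ ∂(timeMeasure T) = ∫ τ in (0 : ℝ)..b, f τ := by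
  have : Set.Iic b = Subtype.val ⁻¹' (Set.Ioc 0 (b : ℝ)) := by
    ext t; exact ⟨fun h => ⟨t.2.1, h⟩, fun h => h.2⟩
  rw [this, measurePreserving_timeInterval_coe.setIntegral_preimage_emb
    measurableEmbedding_timeInterval_coe, Measure.restrict_restrict measurableSet_Ioc,
    Set.inter_eq_self_of_subset_left, ← intervalIntegral.integral_of_le b.2.1.le]
  exact fun x hx => ⟨hx.1, (EReal.coe_le_coe_iff.2 hx.2).trans_lt b.2.2⟩

theorem setIntegral_Icc_timeMeasure {E : Type*} [NormedAddCommGroup E] [NormedSpace ℝ E]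
    {s t : timeInterval T} (h : s ≤ t) (f : ℝ → E) :
    ∫ τ in Set.Icc s t, f τ ∂(timeMeasure T) = ∫ τ in (s : ℝ)..t, f τ := by
  have : Set.Icc s t = Subtype.val ⁻¹' (Set.Icc (s : ℝ) t) := rfl
  rw [this, measurePreserving_timeInterval_coe.setIntegral_preimage_emb
    measurableEmbedding_timeInterval_coe, Measure.restrict_restrict measurableSet_Icc,
    Set.inter_eq_self_of_subset_left (Set.OrdConnected.out inferInstance s.2 t.2),
    integral_Icc_eq_integral_Ioc, ← intervalIntegral.integral_of_le h]

theorem setIntegral_Icc_timeMeasure_eq_extend {s t : timeInterval T} (h : s ≤ t)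
    (g : timeInterval T → ℝ) :
    ∫ τ in Set.Icc s t, g τ ∂(timeMeasure T) =
      ∫ τ in (s : ℝ)..t, Function.extend Subtype.val g 0 τ := by
  rw [← setIntegral_Icc_timeMeasure h]
  simp only [Subtype.val_injective.extend_apply]

theorem MeasureTheory.MemLp.integrableOn_Iic_timeMeasure {p : ℝ≥0∞} (hp : 1 ≤ p)
    {g : timeInterval T → ℝ} (hg : MemLp g p (timeMeasure T)) (b : timeInterval T) :
    IntegrableOn g (Set.Iic b) (timeMeasure T) := by
  have : IsFiniteMeasure ((timeMeasure T).restrict (Set.Iic b)) :=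
    isFiniteMeasure_restrict.2 (timeMeasure_Iic_lt_top b).ne
  exact (hg.restrict _).integrable hp

theorem MeasureTheory.MemLp.intervalIntegrable_extend {p : ℝ≥0∞} (hp : 1 ≤ p)
    {g : timeInterval T → ℝ} (hg : MemLp g p (timeMeasure T)) (b : timeInterval T) :
    IntervalIntegrable (Function.extend Subtype.val g 0) volume 0 b := by
  rw [intervalIntegrable_iff_integrableOn_Ioc_of_le b.2.1.le]
  have h := hg.integrableOn_Iic_timeMeasure hp b
  have e : Set.Iic b = Subtype.val ⁻¹' (Set.Ioc 0 (b : ℝ)) := by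
    ext t; exact ⟨fun h => ⟨t.2.1, h⟩, fun h => h.2⟩
  have e' : g = Function.extend Subtype.val g 0 ∘ Subtype.val :=
    (Function.extend_comp Subtype.val_injective g 0).symm
  rw [e, e', measurePreserving_timeInterval_coe.integrableOn_comp_preimage
    measurableEmbedding_timeInterval_coe, IntegrableOn,
    Measure.restrict_restrict measurableSet_Ioc, Set.inter_eq_self_of_subset_left] at h
  · exact h
  · exact fun x hx => ⟨hx.1, (EReal.coe_le_coe_iff.2 hx.2).trans_lt b.2.2⟩

end TimeInterval

/-! ### Transition operators and measurability of sections. -/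

namespace MonotoneFamily

variable {T : EReal} {V : Type*} [AddCommGroup V] [Module ℝ V] (M : MonotoneFamily T V)

theorem norm_P_le {s t : timeInterval T} (h : s ≤ t) (y : M.X s) : ‖M.P h y‖ ≤ ‖y‖ := by
  induction y using (M.denseRange_toX s).induction_on with
  | hp => exact isClosed_le ((M.P h).continuous.norm) continuous_norm
  | ih v => rw [P_toX, norm_toX, norm_toX]; exact M.antitone_N v h

theorem P_P {s t b : timeInterval T} (h₁ : s ≤ t) (h₂ : t ≤ b) (y : M.X s) :
    M.P h₂ (M.P h₁ y) = M.P (h₁.trans h₂) y := by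
  induction y using (M.denseRange_toX s).induction_on with
  | hp => exact isClosed_eq ((M.P h₂).continuous.comp (M.P h₁).continuous) (M.P _).continuous
  | ih v => rw [P_toX, P_toX, P_toX]

theorem P_self {t : timeInterval T} (y : M.X t) : M.P le_rfl y = y := by
  induction y using (M.denseRange_toX t).induction_on with
  | hp => exact isClosed_eq (M.P _).continuous continuous_id
  | ih v => rw [P_toX]

theorem transport_of_le {b t : timeInterval T} (h : t ≤ b) (f : M.Sec) :
    M.transport b f t = M.P h (f t) := dif_pos h

theorem transport_of_not_le {b t : timeInterval T} (h : ¬ t ≤ b) (f : M.Sec) :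
    M.transport b f t = 0 := dif_neg h

theorem transport_sub (b t : timeInterval T) (f g : M.Sec) :
    M.transport b (f - g) t = M.transport b f t - M.transport b g t := by
  by_cases h : t ≤ b
  · simp only [transport_of_le M h, Pi.sub_apply, map_sub]
  · simp only [transport_of_not_le M h, sub_zero]

theorem norm_transport_le (b t : timeInterval T) (f : M.Sec) : ‖M.transport b f t‖ ≤ ‖f t‖ := by
  by_cases h : t ≤ b
  · rw [transport_of_le M h]; exact M.norm_P_le h _
  · rw [transport_of_not_le M h, norm_zero]; exact norm_nonneg _

theorem tendsto_transport (b t : timeInterval T) {F : ℕ → M.Sec} {f : M.Sec}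
    (h : Tendsto (fun k => F k t) atTop (𝓝 (f t))) :
    Tendsto (fun k => M.transport b (F k) t) atTop (𝓝 (M.transport b f t)) := by
  by_cases hb : t ≤ b
  · simp only [transport_of_le M hb]
    exact ((M.P hb).continuous.tendsto _).comp h
  · simp only [transport_of_not_le M hb, tendsto_const_nhds]

variable {M} in
theorem IsMeasurableSection.aestronglyMeasurable_transport {f : M.Sec}
    (hf : M.IsMeasurableSection f) (b : timeInterval T) :
    AEStronglyMeasurable (M.transport b f) (timeMeasure T) := by
  obtain ⟨F, hF, hFf⟩ := hf
  refine aestronglyMeasurable_of_tendsto_ae atTop (f := fun k => M.transport b (F k)) (fun k => ?_)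
    (hFf.mono fun t ht => M.tendsto_transport b t ht)
  obtain ⟨s, hs⟩ := hF k
  have : M.transport b (F k) = (Set.Iic b).indicator (s.map (M.toX b)) := by
    ext t
    by_cases h : t ≤ b
    · rw [transport_of_le M h, hs, P_toX, Set.indicator_of_mem (show t ∈ Set.Iic b from h)]
      rfl
    · rw [transport_of_not_le M h, Set.indicator_of_notMem (show t ∉ Set.Iic b from h)]
  rw [this]
  exact ((SimpleFunc.stronglyMeasurable _).indicator measurableSet_Iic).aestronglyMeasurable

/-- The closed subspace of `X t` that is spanned by a subset of `V`. -/
noncomputable def closedSpan (C : Set V) (t : timeInterval T) : Submodule ℝ (M.X t) :=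
  ((Submodule.span ℝ C).map (M.toX t)).topologicalClosure

theorem isClosed_closedSpan (C : Set V) (t : timeInterval T) :
    IsClosed (M.closedSpan C t : Set (M.X t)) :=
  Submodule.isClosed_topologicalClosure _

theorem toX_mem_closedSpan {C : Set V} {w : V} (hw : w ∈ Submodule.span ℝ C)
    (t : timeInterval T) : M.toX t w ∈ M.closedSpan C t :=
  Submodule.le_topologicalClosure _ (Submodule.mem_map_of_mem hw)

theorem P_mem_closedSpan {C : Set V} {s t : timeInterval T} (h : s ≤ t) {y : M.X s}
    (hy : y ∈ M.closedSpan C s) : M.P h y ∈ M.closedSpan C t := by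
  have hm : Set.MapsTo (M.P h) ((Submodule.span ℝ C).map (M.toX s) : Set (M.X s))
      ((Submodule.span ℝ C).map (M.toX t) : Set (M.X t)) := by
    rintro _ ⟨w, hw, rfl⟩
    rw [P_toX]
    exact ⟨w, hw, rfl⟩
  exact hm.closure (M.P h).continuous hy

theorem transport_mem_closedSpan {C : Set V} (b : timeInterval T) {t : timeInterval T}
    {f : M.Sec} (hf : f t ∈ M.closedSpan C t) : M.transport b f t ∈ M.closedSpan C b := by
  by_cases h : t ≤ b
  · rw [transport_of_le M h]; exact M.P_mem_closedSpan h hf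
  · rw [transport_of_not_le M h]; exact Submodule.zero_mem _

variable {M} in
-- The values of the approximating simple sections form one countable subset of `V` that works for
-- almost all times.
theorem IsMeasurableSection.exists_countable_closedSpan {f : M.Sec}
    (hf : M.IsMeasurableSection f) :
    ∃ C : Set V, C.Countable ∧ ∀ᵐ t ∂(timeMeasure T), f t ∈ M.closedSpan C t := by
  obtain ⟨F, hF, hFf⟩ := hf
  choose s hs using hF
  refine ⟨⋃ k, Set.range (s k), Set.countable_iUnion fun k => (s k).finite_range.countable, ?_⟩
  filter_upwards [hFf] with t ht
  refine (M.isClosed_closedSpan _ t).mem_of_tendsto ht (Eventually.of_forall fun k => ?_)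
  rw [hs]
  have : s k t ∈ ⋃ k, Set.range (s k) := Set.mem_iUnion.2 ⟨k, Set.mem_range_self t⟩
  exact M.toX_mem_closedSpan (Submodule.subset_span this) t

theorem closedSpan_subset_closure_range {C : Set V} {x : ℕ → V}
    (hx : ∀ w ∈ Submodule.span ℝ C, ∀ q : Seminorm ℝ V, ∀ ε > 0, ∃ n, q (w - x n) < ε)
    (t : timeInterval T) :
    (M.closedSpan C t : Set (M.X t)) ⊆ closure (Set.range fun n => M.toX t (x n)) := by
  refine closure_minimal ?_ isClosed_closure
  rintro _ ⟨w, hw, rfl⟩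
  refine Metric.mem_closure_iff.2 fun ε hε => ?_
  obtain ⟨n, hn⟩ := hx w hw (M.N t) ε hε
  exact ⟨_, ⟨n, rfl⟩, by rwa [dist_eq_norm, ← map_sub, norm_toX]⟩

/-- At times where the norms of a dense sequence are continuous, the norm is determined by the
transports to later times. -/
theorem enorm_eq_iSup_transport {x : ℕ → V} {t : timeInterval T}
    (hx : ∀ n, ContinuousAt (fun s => M.N s (x n)) t) {Q : ℕ → timeInterval T}
    (hQ : DenseRange Q) {f : M.Sec} (hf : f t ∈ closure (Set.range fun n => M.toX t (x n))) :
    ‖f t‖ₑ = ⨆ k, ‖M.transport (Q k) f t‖ₑ := by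
  refine le_antisymm ?_ (iSup_le fun k => ?_)
  · by_cases hS : (⨆ k, ‖M.transport (Q k) f t‖ₑ) = ⊤
    · rw [hS]; exact le_top
    have hi : ∀ k, ‖M.transport (Q k) f t‖ ≤ (⨆ k, ‖M.transport (Q k) f t‖ₑ).toReal := fun k => by
      rw [← toReal_enorm]
      exact ENNReal.toReal_mono hS (le_iSup (fun k => ‖M.transport (Q k) f t‖ₑ) k)
    rw [← ENNReal.ofReal_toReal hS, ← ofReal_norm]
    refine ENNReal.ofReal_le_ofReal (le_of_forall_pos_le_add fun ε hε => ?_)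
    -- Two thirds of `ε` pay for replacing `f t` by `x n` at time `t` and at a later time `Q k`; the
    -- last third pays for the drop of the seminorm of `x n` in between, small by continuity.
    obtain ⟨_, ⟨n, rfl⟩, hn⟩ := Metric.mem_closure_iff.1 hf (ε / 3) (by positivity)
    rw [dist_eq_norm] at hn
    have hev : ∀ᶠ b in 𝓝 t, M.N t (x n) - ε / 3 < M.N b (x n) :=
      (hx n).eventually (eventually_gt_nhds (by linarith))
    obtain ⟨U, hU, hUo, htU⟩ := eventually_nhds_iff.1 hev
    obtain ⟨b₀, hb₀⟩ : ∃ b₀, b₀ ∈ U ∩ Set.Ioi t := by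
      obtain ⟨c, hc⟩ := exists_gt t
      obtain ⟨r, hr, hrU⟩ := exists_Ico_subset_of_mem_nhds (hUo.mem_nhds htU) ⟨c, hc⟩
      obtain ⟨m, h1, h2⟩ := exists_between hr
      exact ⟨m, hrU ⟨h1.le, h2⟩, h1⟩
    obtain ⟨k, hk⟩ := hQ.exists_mem_open (hUo.inter isOpen_Ioi) ⟨b₀, hb₀⟩
    have hkt : t ≤ Q k := le_of_lt hk.2
    have h1 := hU _ hk.1
    have h2 := hi k
    rw [transport_of_le M hkt] at h2
    have h3 : M.N (Q k) (x n) ≤ ‖M.P hkt (f t)‖ + ‖f t - M.toX t (x n)‖ := by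
      rw [← norm_toX, ← M.P_toX hkt]
      have : M.P hkt (M.toX t (x n)) = M.P hkt (f t) - M.P hkt (f t - M.toX t (x n)) := by
        rw [← map_sub]; simp
      rw [this]
      exact (norm_sub_le _ _).trans (by gcongr; exact M.norm_P_le _ _)
    have h4 : ‖f t‖ ≤ M.N t (x n) + ‖f t - M.toX t (x n)‖ := by
      rw [← norm_toX]
      simpa using norm_add_le (M.toX t (x n)) (f t - M.toX t (x n))
    linarith
  · rw [← ofReal_norm, ← ofReal_norm]
    exact ENNReal.ofReal_le_ofReal (M.norm_transport_le _ _ _)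

/-- A monotone function has at most countably many discontinuities. -/
theorem ae_continuousAt_N (x : ℕ → V) :
    ∀ᵐ t ∂(timeMeasure T), ∀ n, ContinuousAt (fun s => M.N s (x n)) t :=
  ae_all_iff.2 fun n => (M.antitone_N (x n)).countable_not_continuousAt.measure_zero _

/-- The norm of a separably valued, weakly measurable section is measurable. -/
theorem aemeasurable_enorm {C : Set V} (hC : C.Countable) [Nonempty (timeInterval T)] {f : M.Sec}
    (hf : ∀ᵐ t ∂(timeMeasure T), f t ∈ M.closedSpan C t)
    (hfm : ∀ (b : timeInterval T) (ℓ : StrongDual ℝ (M.X b)),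
      AEMeasurable (fun t => ℓ (M.transport b f t)) (timeMeasure T)) :
    AEMeasurable (fun t => ‖f t‖ₑ) (timeMeasure T) := by
  obtain ⟨x, -, hx⟩ := exists_seq_dense_span hC
  choose ℓ hℓ hℓn using fun b => exists_norming_functionals fun n => M.toX b (x n)
  let Q := TopologicalSpace.denseSeq (timeInterval T)
  -- The norm is a countable supremum of measurable scalar functions, over dense times `Q k` and
  -- norming functionals on `X (Q k)`.
  have : AEMeasurable (fun t => ⨆ k, ⨆ n, ‖ℓ (Q k) n (M.transport (Q k) f t)‖ₑ) (timeMeasure T) :=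
    AEMeasurable.iSup fun k => AEMeasurable.iSup fun n => (hfm (Q k) (ℓ (Q k) n)).enorm
  refine this.congr ?_
  filter_upwards [hf, M.ae_continuousAt_N x] with t ht htc
  rw [M.enorm_eq_iSup_transport htc (TopologicalSpace.denseRange_denseSeq _)
    (M.closedSpan_subset_closure_range hx t ht)]
  refine iSup_congr fun k => (hℓn (Q k) _ ?_).symm
  exact M.closedSpan_subset_closure_range hx _ (M.transport_mem_closedSpan _ ht)

/-- A separably valued, weakly measurable section is measurable. -/
theorem isMeasurableSection_of_weak {C : Set V} (hC : C.Countable) [Nonempty (timeInterval T)]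
    {f : M.Sec} (hf : ∀ᵐ t ∂(timeMeasure T), f t ∈ M.closedSpan C t)
    (hfm : ∀ (b : timeInterval T) (ℓ : StrongDual ℝ (M.X b)),
      AEMeasurable (fun t => ℓ (M.transport b f t)) (timeMeasure T)) :
    M.IsMeasurableSection f := by
  obtain ⟨x, hxC, hx⟩ := exists_seq_dense_span hC
  have hm : ∀ n, AEMeasurable (fun t => ‖f t - M.toX t (x n)‖ₑ) (timeMeasure T) := fun n => by
    refine M.aemeasurable_enorm hC (f := f - fun t => M.toX t (x n)) ?_ fun b ℓ => ?_
    · filter_upwards [hf] with t ht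
      exact Submodule.sub_mem _ ht (M.toX_mem_closedSpan (hxC n) t)
    · simp only [transport_sub, map_sub]
      refine (hfm b ℓ).sub (Measurable.aemeasurable ?_)
      have : (fun t => ℓ (M.transport b (fun t => M.toX t (x n)) t)) =
          (Set.Iic b).indicator fun _ => ℓ (M.toX b (x n)) := by
        ext t
        by_cases h : t ≤ b
        · rw [transport_of_le M h, P_toX, Set.indicator_of_mem (show t ∈ Set.Iic b from h)]
        · rw [transport_of_not_le M h, map_zero,
            Set.indicator_of_notMem (show t ∉ Set.Iic b from h)]
      rw [this]
      exact measurable_const.indicator measurableSet_Iic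
  -- `s k t` is an index whose `x` is at least as close to `f t` as each of `x 0, …, x k`, the
  -- distances being replaced by measurable versions so that the choice is measurable.
  have hsel : ∀ k, ∃ s : SimpleFunc (timeInterval T) ℕ, ∀ j ≤ k, ∀ t,
      (hm (s t)).mk _ t ≤ (hm j).mk _ t := by
    intro k
    induction k with
    | zero =>
      refine ⟨SimpleFunc.const _ 0, fun j hj t => ?_⟩
      rw [Nat.le_zero.1 hj]; rfl
    | succ k ih =>
      obtain ⟨s, hs⟩ := ih
      have hA : MeasurableSet {t | ∀ j ≤ k, (hm (k + 1)).mk _ t ≤ (hm j).mk _ t} := by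
        simp only [Set.ofPred_forall]
        exact MeasurableSet.iInter fun j => MeasurableSet.iInter fun _ =>
          measurableSet_le (hm _).measurable_mk (hm j).measurable_mk
      refine ⟨SimpleFunc.piecewise _ hA (SimpleFunc.const _ (k + 1)) s, fun j hj t => ?_⟩
      rw [SimpleFunc.piecewise_apply]
      split_ifs with ht
      · rcases Nat.le_succ_iff.1 hj with hj | rfl
        · exact ht j hj
        · exact le_rfl
      · rcases Nat.le_succ_iff.1 hj with hj | rfl
        · exact hs j hj t
        · simp only [Set.mem_ofPred_eq, not_forall, not_le] at ht
          obtain ⟨i, hi, hlt⟩ := ht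
          exact (hs i hi t).trans hlt.le
  choose s hs using hsel
  refine ⟨fun k t => M.toX t (x (s k t)), fun k => ⟨(s k).map x, fun t => rfl⟩, ?_⟩
  filter_upwards [hf, ae_all_iff.2 fun n => (hm n).ae_eq_mk] with t ht hmk
  rw [tendsto_iff_edist_tendsto_0, ENNReal.tendsto_atTop_zero]
  intro ε hε
  obtain ⟨_, ⟨n, rfl⟩, hn⟩ :=
    EMetric.mem_closure_iff.1 (M.closedSpan_subset_closure_range hx t ht) ε hε
  refine ⟨n, fun k hk => ?_⟩
  rw [edist_eq_enorm_sub] at hn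
  rw [edist_comm, edist_eq_enorm_sub, hmk (s k t)]
  refine (hs k n hk t).trans ?_
  rw [← hmk n]
  exact hn.le

end MonotoneFamily

/-- Countably many `b` exhaust the interval. This localises to `(0, b)`, where functions in `L^p`
are integrable even if `T` is infinite. -/
theorem ae_timeMeasure_of_forall_lt {T : EReal} {p : timeInterval T → Prop}
    (h : ∀ b : timeInterval T, ∀ᵐ t ∂(timeMeasure T), t < b → p t) :
    ∀ᵐ t ∂(timeMeasure T), p t := by
  by_cases hT : Nonempty (timeInterval T)
  · filter_upwards [ae_all_iff.2 fun k => h (TopologicalSpace.denseSeq (timeInterval T) k)]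
      with t ht
    obtain ⟨k, hk⟩ := (TopologicalSpace.denseRange_denseSeq (timeInterval T)).exists_mem_open
      (isOpen_Ioi (a := t)) (exists_gt t)
    exact ht k hk
  · exact Eventually.of_forall fun t => absurd ⟨t⟩ hT

theorem ae_timeMeasure_forall_sub_notMem {T : EReal} {E : Set (timeInterval T)}
    (hE : timeMeasure T E = 0) :
    ∀ᵐ t ∂(timeMeasure T), t ∉ E ∧
      ∀ (n : ℕ) (h : (t : ℝ) - 1 / ((n : ℝ) + 1) ∈ timeInterval T), ⟨_, h⟩ ∉ E := by
  filter_upwards [ae_timeMeasure_of_ae (ae_forall_sub_notMem (timeMeasure_eq_zero_iff.1 hE))]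
    with t ht
  exact ⟨fun h => ht.1 ⟨t, h, rfl⟩, fun n h hn => ht.2 n ⟨_, hn, rfl⟩⟩

theorem eventually_sub_mem_timeInterval {T : EReal} (t : timeInterval T) :
    ∀ᶠ n : ℕ in atTop, (t : ℝ) - 1 / ((n : ℝ) + 1) ∈ timeInterval T := by
  filter_upwards [(tendsto_one_div_add_atTop_nhds_zero_nat (𝕜 := ℝ)).eventually_lt_const t.2.1]
    with n hn
  have : (0 : ℝ) < 1 / ((n : ℝ) + 1) := by positivity
  exact ⟨sub_pos.2 hn, (EReal.coe_lt_coe_iff.2 (by linarith)).trans t.2.2⟩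

theorem sub_le_timeInterval {T : EReal} {t : timeInterval T} {n : ℕ}
    (h : (t : ℝ) - 1 / ((n : ℝ) + 1) ∈ timeInterval T) :
    (⟨(t : ℝ) - 1 / ((n : ℝ) + 1), h⟩ : timeInterval T) ≤ t := by
  have : (0 : ℝ) < 1 / ((n : ℝ) + 1) := by positivity
  exact Subtype.coe_le_coe.1 (show (t : ℝ) - 1 / ((n : ℝ) + 1) ≤ t by linarith)

/-! ### Backward difference quotients and their weak limit. -/

namespace MonotoneFamily

variable {T : EReal} {V : Type*} [AddCommGroup V] [Module ℝ V] (M : MonotoneFamily T V)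

/-- The difference quotient of a section between the times `t - 1 / (n + 1)` and `t`. -/
noncomputable def backwardQuotient (u : M.Sec) (n : ℕ) : M.Sec := fun t =>
  open scoped Classical in
  if h : (t : ℝ) - 1 / ((n : ℝ) + 1) ∈ timeInterval T then
    ((n : ℝ) + 1) • (u t - M.P (sub_le_timeInterval h) (u ⟨_, h⟩)) else 0

theorem backwardQuotient_of_mem (u : M.Sec) {n : ℕ} {t : timeInterval T}
    (h : (t : ℝ) - 1 / ((n : ℝ) + 1) ∈ timeInterval T) :
    M.backwardQuotient u n t =
      ((n : ℝ) + 1) • (u t - M.P (sub_le_timeInterval h) (u ⟨_, h⟩)) := dif_pos h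

/-- The weak limit of the difference quotients of a section along a fixed ultrafilter (zero where
it does not exist). -/
noncomputable def weakQuotientLimit (u : M.Sec) : M.Sec := fun t =>
  open scoped Classical in
  if h : ∃ v : M.X t, ∀ ℓ : StrongDual ℝ (M.X t),
      Tendsto (fun n => ℓ (M.backwardQuotient u n t)) (hyperfilter ℕ) (𝓝 (ℓ v)) then h.choose else 0

variable {M} {p : ℝ≥0∞} {u : M.Sec} {g : timeInterval T → ℝ}

theorem IsUpperGradient.ae_norm_backwardQuotient_le (hg : M.IsUpperGradient p u g) :
    ∀ᵐ t : timeInterval T ∂(timeMeasure T), ∀ᶠ n : ℕ in atTop, ‖M.backwardQuotient u n t‖ ≤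
      ((n : ℝ) + 1) * ∫ τ in ((t : ℝ) - 1 / ((n : ℝ) + 1))..t,
        Function.extend Subtype.val g 0 τ := by
  obtain ⟨E, hE, hEg⟩ := hg.2
  filter_upwards [ae_timeMeasure_forall_sub_notMem hE] with t ht
  filter_upwards [eventually_sub_mem_timeInterval t] with n hn
  rw [backwardQuotient_of_mem M u hn, norm_smul, Real.norm_of_nonneg (by positivity)]
  have := hEg _ _ (sub_le_timeInterval hn) (ht.2 n hn) ht.1
  rw [setIntegral_Icc_timeMeasure_eq_extend (sub_le_timeInterval hn)] at this
  exact mul_le_mul_of_nonneg_left this (by positivity)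

theorem IsUpperGradient.ae_tendsto_average (hp : 1 ≤ p) (hg : M.IsUpperGradient p u g) :
    ∀ᵐ t : timeInterval T ∂(timeMeasure T), Tendsto (fun n : ℕ => ((n : ℝ) + 1) *
      ∫ τ in ((t : ℝ) - 1 / ((n : ℝ) + 1))..t, Function.extend Subtype.val g 0 τ) atTop
        (𝓝 (g t)) := by
  refine ae_timeMeasure_of_forall_lt fun b => ?_
  filter_upwards [ae_timeMeasure_of_ae (ae_tendsto_backward_average b.2.1.le
    (hg.1.intervalIntegrable_extend hp b))] with t ht htb
  have := ht ⟨t.2.1, htb⟩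
  rwa [Subtype.val_injective.extend_apply] at this

theorem IsUpperGradient.ae_tendsto_weakQuotientLimit (hM : ∀ t, IsReflexiveSpace (M.X t))
    (hp : 1 ≤ p) (hg : M.IsUpperGradient p u g) :
    ∀ᵐ t ∂(timeMeasure T), ∀ ℓ : StrongDual ℝ (M.X t),
      Tendsto (fun n => ℓ (M.backwardQuotient u n t)) (hyperfilter ℕ)
        (𝓝 (ℓ (M.weakQuotientLimit u t))) := by
  filter_upwards [hg.ae_norm_backwardQuotient_le, hg.ae_tendsto_average hp] with t h₁ h₂
  have h : ∃ v : M.X t, ∀ ℓ : StrongDual ℝ (M.X t),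
      Tendsto (fun n => ℓ (M.backwardQuotient u n t)) (hyperfilter ℕ) (𝓝 (ℓ v)) := by
    -- The bounding averages converge to `g t`, so they are eventually at most `g t + 1`.
    refine (hM t).exists_weak_limit (hyperfilter ℕ) (C := g t + 1) (Nat.hyperfilter_le_atTop ?_)
    filter_upwards [h₁, h₂.eventually_le_const (lt_add_one (g t))] with n hn hn'
    exact hn.trans hn'
  rw [weakQuotientLimit, dif_pos h]
  exact h.choose_spec

/-- Weak lower semicontinuity of the norm. The left side is independent of `g`, so the bound applies
to every upper gradient. -/
theorem IsUpperGradient.ae_norm_weakQuotientLimit_le (hM : ∀ t, IsReflexiveSpace (M.X t))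
    (hp : 1 ≤ p) (hg : M.IsUpperGradient p u g) :
    ∀ᵐ t ∂(timeMeasure T), ‖M.weakQuotientLimit u t‖ ≤ g t := by
  filter_upwards [hg.ae_norm_backwardQuotient_le, hg.ae_tendsto_average hp,
    hg.ae_tendsto_weakQuotientLimit hM hp] with t h₁ h₂ h₃
  exact norm_le_of_weak_limit h₃ (h₂.mono_left Nat.hyperfilter_le_atTop)
    (Nat.hyperfilter_le_atTop h₁)

theorem IsUpperGradient.ae_weakQuotientLimit_mem (hM : ∀ t, IsReflexiveSpace (M.X t))
    (hp : 1 ≤ p) (hg : M.IsUpperGradient p u g) {C : Set V}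
    (hC : ∀ᵐ t ∂(timeMeasure T), u t ∈ M.closedSpan C t) :
    ∀ᵐ t ∂(timeMeasure T), M.weakQuotientLimit u t ∈ M.closedSpan C t := by
  filter_upwards [hg.ae_tendsto_weakQuotientLimit hM hp,
    ae_timeMeasure_forall_sub_notMem (ae_iff.1 hC)] with t h₁ h₂
  refine mem_of_weak_limit h₁ (M.isClosed_closedSpan C t) (Nat.hyperfilter_le_atTop ?_)
  filter_upwards [eventually_sub_mem_timeInterval t] with n hn
  rw [backwardQuotient_of_mem M u hn]
  exact Submodule.smul_mem _ _ (Submodule.sub_mem _ (not_not.1 h₂.1)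
    (M.P_mem_closedSpan _ (not_not.1 (h₂.2 n hn))))

/-- Transport turns quotients in varying spaces into ordinary difference quotients of a curve in the
fixed space `X b`. -/
theorem transport_backwardQuotient {b t : timeInterval T} (h : t ≤ b) {n : ℕ}
    (hn : (t : ℝ) - 1 / ((n : ℝ) + 1) ∈ timeInterval T) :
    M.P h (M.backwardQuotient u n t) =
      ((n : ℝ) + 1) • (M.transport b u t - M.transport b u ⟨_, hn⟩) := by
  rw [backwardQuotient_of_mem M u hn, map_smul, map_sub, P_P, transport_of_le M h,
    transport_of_le M ((sub_le_timeInterval hn).trans h)]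

/-- The weak limit of the difference quotients is the derivative of `u`, tested with a functional
on a fixed space `X b`. -/
theorem IsUpperGradient.exists_deriv_transport (hM : ∀ t, IsReflexiveSpace (M.X t)) (hp : 1 ≤ p)
    (hg : MemLp g p (timeMeasure T)) {E : Set (timeInterval T)} (hE : timeMeasure T E = 0)
    (hEg : ∀ (s t : timeInterval T) (h : s ≤ t), s ∉ E → t ∉ E →
        ‖u t - M.P h (u s)‖ ≤ ∫ τ in Set.Icc s t, g τ ∂(timeMeasure T))
    (b : timeInterval T) (ℓ : StrongDual ℝ (M.X b)) :
    ∃ D : ℝ → ℝ, Measurable D ∧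
      (∀ᵐ t ∂(timeMeasure T), t ≤ b →
        ℓ (M.transport b (M.weakQuotientLimit u) t) = D (t : ℝ)) ∧
      (∀ s t : timeInterval T, s ≤ t → t ≤ b → s ∉ E → t ∉ E →
        ℓ (M.transport b u t) - ℓ (M.transport b u s) =
          ∫ τ in Set.Icc s t, D (τ : ℝ) ∂(timeMeasure T)) ∧
      ∀ φ : ℝ → ℝ, ContDiff ℝ 1 φ → φ 0 = 0 → φ b = 0 →
        (∫ t in Set.Iic b, deriv φ (t : ℝ) * ℓ (M.transport b u t) ∂(timeMeasure T)) +
          ∫ t in Set.Iic b, φ (t : ℝ) * D (t : ℝ) ∂(timeMeasure T) = 0 := by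
  set f : ℝ → ℝ := Function.extend Subtype.val (fun t => ℓ (M.transport b u t)) 0
  have hf : ∀ t : timeInterval T, f t = ℓ (M.transport b u t) := fun t =>
    Subtype.val_injective.extend_apply _ _ _
  have hmem : ∀ t : ℝ, 0 < t → t ≤ b → t ∈ timeInterval T := fun t h0 h1 =>
    ⟨h0, (EReal.coe_le_coe_iff.2 h1).trans_lt b.2.2⟩
  -- Transition operators are contractions, so `‖ℓ‖ * g` is an upper gradient of the scalar function
  -- `f`.
  have hfle : ∀ s t : ℝ, 0 < s → s ≤ t → t ≤ b → s ∉ Subtype.val '' E → t ∉ Subtype.val '' E →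
      |f t - f s| ≤ ∫ τ in s..t, ‖ℓ‖ * Function.extend Subtype.val g 0 τ := by
    intro s t h0 hst htb hs ht
    lift t to timeInterval T using hmem t (h0.trans_le hst) htb
    lift s to timeInterval T using hmem s h0 (hst.trans htb)
    have hst' : s ≤ t := hst
    have htb' : t ≤ b := htb
    rw [hf, hf, intervalIntegral.integral_const_mul,
      ← setIntegral_Icc_timeMeasure_eq_extend hst', transport_of_le M htb',
      transport_of_le M (hst'.trans htb'), ← M.P_P hst' htb', ← map_sub, ← map_sub,
      ← Real.norm_eq_abs]
    refine (ℓ.le_opNorm _).trans (mul_le_mul_of_nonneg_left ?_ (norm_nonneg _))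
    exact (M.norm_P_le _ _).trans (hEg s t hst' (fun h => hs ⟨s, h, rfl⟩) fun h => ht ⟨t, h, rfl⟩)
  obtain ⟨D, hDm, hDE, hDφ, hDt⟩ := exists_deriv_of_abs_sub_le_integral b.2.1.le
    (timeMeasure_eq_zero_iff.1 hE) ((hg.intervalIntegrable_extend hp b).const_mul ‖ℓ‖) hfle
  refine ⟨D, hDm, ?_, ?_, ?_⟩
  · have hug : M.IsUpperGradient p u g := ⟨hg, E, hE, hEg⟩
    filter_upwards [ae_timeMeasure_of_ae hDt, hug.ae_tendsto_weakQuotientLimit hM hp,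
      measure_eq_zero_iff_ae_notMem.1 (measure_singleton (μ := timeMeasure T) b)]
      with t h₁ h₂ h₃ htb
    have htb' : t < b := lt_of_le_of_ne htb h₃
    rw [transport_of_le M htb]
    -- Testing the weak limit in `X t` with `ℓ ∘ P` gives the ultrafilter limit of the scalar
    -- quotients, which converge classically to `D t`.
    refine tendsto_nhds_unique (h₂ (ℓ.comp (M.P htb)))
      (((h₁ ⟨t.2.1, htb'⟩).mono_left Nat.hyperfilter_le_atTop).congr'
        (Nat.hyperfilter_le_atTop ?_))
    filter_upwards [eventually_sub_mem_timeInterval t] with n hn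
    rw [ContinuousLinearMap.comp_apply, transport_backwardQuotient htb hn, map_smul, map_sub,
      smul_eq_mul, ← hf, ← hf]
  · intro s t hst htb hs ht
    rw [setIntegral_Icc_timeMeasure hst, ← hf, ← hf]
    exact hDE s t s.2.1 hst htb (fun ⟨_, h, h'⟩ => hs (Subtype.ext h' ▸ h))
      (fun ⟨_, h, h'⟩ => ht (Subtype.ext h' ▸ h))
  · intro φ hφ h0 hb
    rw [setIntegral_Iic_timeMeasure b fun t => φ t * D t]
    simp only [← hf]
    rw [setIntegral_Iic_timeMeasure b fun t => deriv φ t * f t]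
    exact hDφ φ hφ h0 hb

theorem integrable_transport (hp : 1 ≤ p) (hu : M.MemLpSec p u) (b : timeInterval T) :
    Integrable (M.transport b u) (timeMeasure T) := by
  have h : IntegrableOn (M.transport b u) (Set.Iic b) (timeMeasure T) :=
    (hu.2.integrableOn_Iic_timeMeasure hp b).mono' (hu.1.aestronglyMeasurable_transport b).restrict
      (Eventually.of_forall fun t => M.norm_transport_le b t u)
  exact h.integrable_of_forall_notMem_eq_zero fun t ht => M.transport_of_not_le ht u

theorem MemLpSec.memL1LocSec (hp : 1 ≤ p) (hu : M.MemLpSec p u) : M.MemL1LocSec u :=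
  ⟨hu.1, hu.2.locallyIntegrable hp⟩

/-- Duality reduces a pairing of a section with a test function to a scalar integral. -/
theorem apply_integral_smul_transport (hp : 1 ≤ p) (hu : M.MemLpSec p u) (b : timeInterval T)
    (ℓ : StrongDual ℝ (M.X b)) {ψ : ℝ → ℝ} (hψ : Continuous ψ) (hψc : HasCompactSupport ψ) :
    ℓ (∫ t, ψ (t : ℝ) • M.transport b u t ∂(timeMeasure T)) =
      ∫ t in Set.Iic b, ψ (t : ℝ) * ℓ (M.transport b u t) ∂(timeMeasure T) := by
  obtain ⟨c, hc⟩ := hψc.exists_bound_of_continuous hψ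
  have hint : Integrable (fun t : timeInterval T => ψ (t : ℝ) • M.transport b u t)
      (timeMeasure T) :=
    (integrable_transport hp hu b).bdd_smul c
      (hψ.comp continuous_subtype_val).aestronglyMeasurable (Eventually.of_forall fun t => hc t)
  rw [← ℓ.integral_comp_comm hint, setIntegral_eq_integral_of_forall_compl_eq_zero]
  · simp only [map_smul, smul_eq_mul]
  · intro t ht
    rw [M.transport_of_not_le ht, map_zero, mul_zero]

end MonotoneFamily

/-! ### The weak derivative and the minimal upper gradient. -/

theorem timeInterval_nonempty {T : EReal} (hT : 0 < T) : Nonempty (timeInterval T) := by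
  obtain ⟨r, h0, h1⟩ := EReal.lt_iff_exists_real_btwn.1 hT
  exact ⟨⟨r, EReal.coe_lt_coe_iff.1 h0, h1⟩⟩

/-- Removes the boundary term at `b` in the integration by parts. -/
theorem eq_zero_of_isLUB_tsupport {φ : ℝ → ℝ} (hφ : Continuous φ) {b : ℝ}
    (hb : IsLUB (tsupport φ) b) : φ b = 0 := by
  have h : Set.Ioi b ⊆ {x | φ x = 0} := fun x hx =>
    image_eq_zero_of_notMem_tsupport fun hx' => (hb.1 hx').not_gt hx
  have h' := closure_minimal h (isClosed_eq hφ continuous_const)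
  rw [closure_Ioi] at h'
  exact h' Set.self_mem_Ici

namespace MonotoneFamily

variable {T : EReal} {V : Type*} [AddCommGroup V] [Module ℝ V] {M : MonotoneFamily T V}
  {p : ℝ≥0∞} {u : M.Sec} {g : timeInterval T → ℝ}

theorem IsUpperGradient.aemeasurable_transport_weakQuotientLimit
    (hM : ∀ t, IsReflexiveSpace (M.X t)) (hp : 1 ≤ p) (hg : M.IsUpperGradient p u g)
    (b : timeInterval T) (ℓ : StrongDual ℝ (M.X b)) :
    AEMeasurable (fun t => ℓ (M.transport b (M.weakQuotientLimit u) t)) (timeMeasure T) := by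
  obtain ⟨hgp, E, hE, hEg⟩ := hg
  obtain ⟨D, hD, hDv, -⟩ := exists_deriv_transport hM hp hgp hE hEg b ℓ
  refine ⟨(Set.Iic b).indicator fun t => D t,
    (hD.comp measurable_subtype_coe).indicator measurableSet_Iic, ?_⟩
  filter_upwards [hDv] with t ht
  by_cases htb : t ∈ Set.Iic b
  · rw [Set.indicator_of_mem htb, ht htb]
  · rw [Set.indicator_of_notMem htb, M.transport_of_not_le htb, map_zero]

theorem IsUpperGradient.memLpSec_weakQuotientLimit (hT : 0 < T)
    (hM : ∀ t, IsReflexiveSpace (M.X t)) (hp : 1 ≤ p) (hu : M.IsMeasurableSection u)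
    (hg : M.IsUpperGradient p u g) : M.MemLpSec p (M.weakQuotientLimit u) := by
  have := timeInterval_nonempty hT
  obtain ⟨C, hC, huC⟩ := hu.exists_countable_closedSpan
  have hvC := hg.ae_weakQuotientLimit_mem hM hp huC
  have hvm := hg.aemeasurable_transport_weakQuotientLimit hM hp
  refine ⟨M.isMeasurableSection_of_weak hC hvC hvm, hg.1.mono ?_ ?_⟩
  · have := (M.aemeasurable_enorm hC hvC hvm).ennreal_toReal
    simp only [toReal_enorm] at this
    exact this.aestronglyMeasurable
  · filter_upwards [hg.ae_norm_weakQuotientLimit_le hM hp] with t ht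
    rw [norm_norm]
    exact ht.trans (Real.le_norm_self _)

theorem IsUpperGradient.isWeakDeriv_weakQuotientLimit (hT : 0 < T)
    (hM : ∀ t, IsReflexiveSpace (M.X t)) (hp : 1 ≤ p) (hu : M.MemLpSec p u)
    (hg : M.IsUpperGradient p u g) : M.IsWeakDeriv u (M.weakQuotientLimit u) := by
  have hv := hg.memLpSec_weakQuotientLimit hT hM hp hu.1
  refine ⟨hu.memL1LocSec hp, hv.memL1LocSec hp, fun φ hφ hφc hφT b hb => ?_⟩
  obtain ⟨hgp, E, hE, hEg⟩ := hg
  -- A functional attaining the norm of the sum that has to vanish; it suffices that `ℓ` kills this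
  -- sum.
  obtain ⟨ℓ, -, hℓ⟩ := exists_dual_vector'' ℝ
    ((∫ t, deriv φ (t : ℝ) • M.transport b u t ∂(timeMeasure T)) +
      (∫ t, φ (t : ℝ) • M.transport b (M.weakQuotientLimit u) t ∂(timeMeasure T)))
  obtain ⟨D, -, hDv, -, hDφ⟩ := exists_deriv_transport hM hp hgp hE hEg b ℓ
  have h1 : ContDiff ℝ 1 φ := hφ.of_le (by exact_mod_cast le_top)
  have h0 : φ 0 = 0 := image_eq_zero_of_notMem_tsupport fun h => lt_irrefl _ (hφT h).1
  have h2 : ∫ t in Set.Iic b, φ (t : ℝ) * ℓ (M.transport b (M.weakQuotientLimit u) t)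
      ∂(timeMeasure T) = ∫ t in Set.Iic b, φ (t : ℝ) * D (t : ℝ) ∂(timeMeasure T) := by
    refine setIntegral_congr_ae measurableSet_Iic ?_
    filter_upwards [hDv] with t ht htb
    rw [ht htb]
  rw [map_add, apply_integral_smul_transport hp hu b ℓ (h1.continuous_deriv le_rfl) hφc.deriv,
    apply_integral_smul_transport hp hv b ℓ h1.continuous hφc, h2,
    hDφ φ h1 h0 (eq_zero_of_isLUB_tsupport h1.continuous hb)] at hℓ
  exact norm_eq_zero.1 hℓ.symm

theorem IsUpperGradient.isUpperGradient_norm_weakQuotientLimit (hT : 0 < T)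
    (hM : ∀ t, IsReflexiveSpace (M.X t)) (hp : 1 ≤ p) (hu : M.IsMeasurableSection u)
    (hg : M.IsUpperGradient p u g) :
    M.IsUpperGradient p u fun t => ‖M.weakQuotientLimit u t‖ := by
  have hv := hg.memLpSec_weakQuotientLimit hT hM hp hu
  obtain ⟨hgp, E, hE, hEg⟩ := hg
  refine ⟨hv.2, E, hE, fun s t hst hs ht => ?_⟩
  -- With `b = t` and `ℓ` norming the increment, the increment's norm is the integral of `D`, and
  -- `|D| ≤ ‖v‖` almost everywhere on `[s, t]` because `‖ℓ‖ ≤ 1` and transport is a contraction.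
  obtain ⟨ℓ, hℓ, hℓu⟩ := exists_dual_vector'' ℝ (u t - M.P hst (u s))
  obtain ⟨D, -, hDv, hDE, -⟩ := exists_deriv_transport hM hp hgp hE hEg t ℓ
  have h := hDE s t hst le_rfl hs ht
  rw [M.transport_of_le le_rfl, M.transport_of_le hst, P_self, ← map_sub, hℓu] at h
  have h' : ‖u t - M.P hst (u s)‖ = ∫ τ in Set.Icc s t, D (τ : ℝ) ∂(timeMeasure T) := h
  rw [h']
  refine (Real.le_norm_self _).trans (norm_integral_le_of_norm_le
    ((hv.2.integrableOn_Iic_timeMeasure hp t).mono_set Set.Icc_subset_Iic_self) ?_)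
  filter_upwards [ae_restrict_mem measurableSet_Icc, ae_restrict_of_ae hDv] with τ hτ hτD
  rw [← hτD hτ.2]
  refine (ℓ.le_of_opNorm_le hℓ _).trans ?_
  rw [one_mul]
  exact M.norm_transport_le _ _ _

end MonotoneFamily

theorem theorem4p5 {V : Type*} [AddCommGroup V] [Module ℝ V] (T : EReal) (hT : 0 < T)
    (M : MonotoneFamily T V) (hM : ∀ t : timeInterval T, IsReflexiveSpace (M.X t))
    (p : ℝ≥0∞) (hp : 1 ≤ p) (u : M.Sec) (hu : M.MemW1p p u) :
    ∃ v : M.Sec,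
      M.MemLpSec p v ∧
      M.IsWeakDeriv u v ∧
      M.IsUpperGradient p u (fun t => ‖v t‖) ∧
      M.secLpNorm p v = ⨅ g ∈ {g : timeInterval T → ℝ | M.IsUpperGradient p u g},
        eLpNorm g p (timeMeasure T) := by
  obtain ⟨hup, g, hg⟩ := hu
  have hv := hg.isUpperGradient_norm_weakQuotientLimit hT hM hp hup.1
  refine ⟨M.weakQuotientLimit u, hg.memLpSec_weakQuotientLimit hT hM hp hup.1,
    hg.isWeakDeriv_weakQuotientLimit hT hM hp hup, hv, le_antisymm ?_ ?_⟩
  · refine le_iInf₂ fun g' hg' => eLpNorm_mono_ae ?_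
    have hg' : M.IsUpperGradient p u g' := hg'
    filter_upwards [hg'.ae_norm_weakQuotientLimit_le hM hp] with t ht
    rw [norm_norm]
    exact ht.trans (Real.le_norm_self _)
  · exact iInf₂_le (fun t => ‖M.weakQuotientLimit u t‖) hv
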